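/- All graphs are finite and simple. Let $B=(V,E)$ be a bicyclic graph, i.e. a connected graph with $|E|=|V|+1$. Fix any orientation of the edges of $B$, and let $A_B$ be the real matrix with rows indexed by $E$ and columns indexed by $V\cup E$ given, for an edge $e$ oriented from $u$ to $v$ and $y\in V\cup E$, by $$A_B[e,y]=\begin{cases}1 & \text{if } y=v, \text{ or } y\neq e \text{ is an edge incident to } v,\\ -1 & \text{if } y=u, \text{ or } y\neq e \text{ is an edge incident to } u,\\ 0 & \text{otherwise.}\end{cases}$$ For a real matrix $A$, the permanent index $\mathrm{pind}(A)$ is the least integer $k$ for which there is a square matrix $A'$ with $\mathrm{per}(A')\neq 0$ such that each column of $A'$ is a column of $A$ and each column of $A$ occurs in $A'$ at most $k$ times (columns being counted by their index). Then $$\mathrm{pind}(A_B)=1 .$$ Moreover, $B$ is $(2,2)$-choosable: for every assignment $L$ of a set $L(z)$ of two real numbers to each $z\in V\cup E$, there is a map $f:V\cup E\to\mathbb{R}$ with $f(z)\in L(z)$ for all $z\in V\cup E$ such that, for any two adjacent vertices $u,v$, $$f(u)+\sum_{e\ni u}f(e)\neq f(v)+\sum_{e\ni v}f(e),$$ where the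 sums are over the edges incident to $u$ and to $v$, respectively. -/

import Mathlib

namespace TotalWeight

/-- The set of natural numbers `k` such that some square matrix with non-zero permanent has all
its columns among the columns of `A`, each column of `A` being used at most `k` times. The square
matrix is given by the function `c` telling which column of `A` stands at each place. -/
def columnMultiplicities {m n : Type*} [Fintype m] [DecidableEq m] [DecidableEq n]
    (A : Matrix m n ℝ) : Set ℕ :=
  {k | ∃ c : m → n, (A.submatrix id c).permanent ≠ 0 ∧
    ∀ j : n, (Finset.univ.filter (fun i : m => c i = j)).card ≤ k}

/-- The permanent index of `A`: the least `k` in `columnMultiplicities A`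
(and `⊤` if there is no such `k`). -/
noncomputable def pind {m n : Type*} [Fintype m] [DecidableEq m] [DecidableEq n]
    (A : Matrix m n ℝ) : ℕ∞ :=
  ⨅ k ∈ columnMultiplicities A, (k : ℕ∞)

/-- An orientation of a simple graph: every edge `e` gets a tail and a head, so that `e` is
oriented from `tail e` to `head e`. -/
structure Orientation {V : Type*} (G : SimpleGraph V) where
  /-- the initial vertex of an edge -/
  tail : G.edgeSet → V
  /-- the terminal vertex of an edge -/
  head : G.edgeSet → V
  /-- the two ends of the edge are its tail and its head -/
  ends : ∀ e : G.edgeSet, (e : Sym2 V) = s(tail e, head e)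

/-- The element `y` of `V ∪ E` is the vertex `v`, or it is an edge other than `e` that is
incident to `v`. -/
def Meets {V : Type*} {G : SimpleGraph V} (e : G.edgeSet) (v : V) : V ⊕ G.edgeSet → Prop
  | Sum.inl w => w = v
  | Sum.inr f => f ≠ e ∧ v ∈ (f : Sym2 V)

/-- The matrix `A_G` of an oriented graph, with rows indexed by the edges and columns indexed by
the vertices and edges. -/
noncomputable def matrixA {V : Type*} {G : SimpleGraph V} (D : Orientation G) :
    Matrix G.edgeSet (V ⊕ G.edgeSet) ℝ :=
  open Classical in
  Matrix.of fun e y =>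
    if Meets e (D.head e) y then 1
    else if Meets e (D.tail e) y then -1
    else 0

section Weighting

variable {V : Type*} [Fintype V] [DecidableEq V] (G : SimpleGraph V) [DecidableRel G.Adj]

/-- The weight `s(v) = f(v) + ∑ f(e)` of a vertex, the sum being over the edges incident
to `v`. -/
def weight (f : V ⊕ G.edgeSet → ℝ) (v : V) : ℝ :=
  f (Sum.inl v) +
    ∑ e ∈ Finset.univ.filter (fun e : G.edgeSet => v ∈ (e : Sym2 V)), f (Sum.inr e)

/-- A total weighting is proper if adjacent vertices have different weights. -/
def IsProper (f : V ⊕ G.edgeSet → ℝ) : Prop :=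
  ∀ u v : V, G.Adj u v → weight G f u ≠ weight G f v

/-- Total weight `ψ`-choosability. -/
def IsPsiChoosable (ψ : V ⊕ G.edgeSet → ℕ) : Prop :=
  ∀ L : V ⊕ G.edgeSet → Finset ℝ, (∀ z, (L z).card = ψ z) →
    ∃ f : V ⊕ G.edgeSet → ℝ, (∀ z, f z ∈ L z) ∧ IsProper G f

/-- Total weight `(k, k')`-choosability: lists of size `k` on vertices and `k'` on edges. -/
def IsChoosable (k k' : ℕ) : Prop :=
  IsPsiChoosable G (Sum.elim (fun _ => k) (fun _ => k'))

/-- A bicyclic graph: a connected graph with one more edge than vertices. -/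
def IsBicyclic : Prop :=
  G.Connected ∧ G.edgeFinset.card = Fintype.card V + 1

end Weighting

end TotalWeight

open MvPolynomial

set_option linter.unusedSectionVars false

namespace TotalWeight

/-! Let `P` be the product of `x_head - x_tail` over all edges. Substituting for each `x_v` the
weight of `v` turns `P` into the product of the row forms of `A_B`. The coefficient there of the
squarefree monomial of a set `S` of vertices and edges is, if non-zero, a permanent of the columns
in `S`, so the permanent index is at most 1; the Combinatorial Nullstellensatz then gives
choosability from lists of size two. By the chain rule this coefficient is the apolar pairing of `P`
with the product of the forms `x_v`, `x_u + x_v` of the elements of `S` (`pairing_setForm`). It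
remains to find an `S` with non-zero pairing.

Such sets are built by adding vertices to connected induced subgraphs. A new vertex `v` with `d`
edges into `W` contributes `x_v ^ d` (`pairing_X_pow_ne_zero`). To keep the product squarefree, all
but one factor `x_v` are traded, through `x_v = (x_v + x_u) - x_u`, for the edge `vu` or for a
neighbour `u` not yet used. So `S` must leave some vertices free: in a tree any two non-adjacent
ones (`IsTreeOn.exists_isGood`), in a unicyclic graph any single one (`exists_isGood_unicyclic`).
This suffices for `exists_isGood_bicyclic`, where `d ≤ 3`. -/

theorem linearMap_ext_monomial {V : Type*} {f₁ f₂ : MvPolynomial V ℝ →ₗ[ℝ] ℝ}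
    (h : ∀ s, f₁ (monomial s 1) = f₂ (monomial s 1)) : f₁ = f₂ :=
  (basisMonomials V ℝ).ext fun s => by simpa using h s

/-! ### The apolar pairing. -/

section Pairing

variable {V : Type*} [Fintype V]

/-- The apolar bilinear form on polynomials, for which distinct monomials are orthogonal and the
square of `x ^ s` is `s!`. -/
noncomputable def pairing : MvPolynomial V ℝ →ₗ[ℝ] MvPolynomial V ℝ →ₗ[ℝ] ℝ :=
  (basisMonomials V ℝ).constr ℝ fun s => (∏ i, ((s i).factorial : ℝ)) • lcoeff ℝ s

theorem pairing_monomial (s : V →₀ ℕ) (g : MvPolynomial V ℝ) :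
    pairing (monomial s 1) g = (∏ i, ((s i).factorial : ℝ)) * coeff s g := by
  have := (basisMonomials V ℝ).constr_basis ℝ
    (fun s => (∏ i, ((s i).factorial : ℝ)) • lcoeff ℝ s) s
  rw [coe_basisMonomials] at this
  rw [pairing, this]
  simp [lcoeff]

theorem pairing_comm (f g : MvPolynomial V ℝ) : pairing f g = pairing g f := by
  classical
  have : (pairing : MvPolynomial V ℝ →ₗ[ℝ] MvPolynomial V ℝ →ₗ[ℝ] ℝ) = pairing.flip := by
    refine (basisMonomials V ℝ).ext fun s => (basisMonomials V ℝ).ext fun t => ?_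
    simp only [coe_basisMonomials, LinearMap.flip_apply, pairing_monomial, coeff_monomial]
    by_cases h : s = t
    · subst h; simp
    · simp [h, Ne.symm h]
  exact congrArg (fun L => L f g) this

theorem pairing_one (g : MvPolynomial V ℝ) : pairing 1 g = constantCoeff g := by
  simpa [-coeff_zero, ← constantCoeff_eq] using pairing_monomial 0 g

/-- The factorial weights of the pairing are chosen for this adjointness: `(k + 1)! = (k + 1) * k!`.
-/
theorem pairing_X_mul (v : V) (f g : MvPolynomial V ℝ) :
    pairing (X v * f) g = pairing f (pderiv v g) := by
  classical
  suffices h : (pairing.flip g) ∘ₗ LinearMap.mulLeft ℝ (X v) = pairing.flip (pderiv v g) from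
    congrArg (fun L => L f) h
  refine linearMap_ext_monomial fun s => ?_
  have hX : X v * monomial s (1 : ℝ) = monomial (s + Finsupp.single v 1) 1 := by
    rw [X, monomial_mul, one_mul, add_comm]
  simp only [LinearMap.comp_apply, LinearMap.mulLeft_apply, LinearMap.flip_apply, hX,
    pairing_monomial, coeff_pderiv]
  rw [← Finset.mul_prod_erase _ _ (Finset.mem_univ v),
    ← Finset.mul_prod_erase _ (fun i => ((s i).factorial : ℝ)) (Finset.mem_univ v)]
  have : ∏ i ∈ Finset.univ.erase v, (((s + Finsupp.single v 1 : V →₀ ℕ) i).factorial : ℝ) =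
      ∏ i ∈ Finset.univ.erase v, ((s i).factorial : ℝ) := by
    refine Finset.prod_congr rfl fun i hi => ?_
    simp [Finsupp.single_eq_of_ne (Finset.ne_of_mem_erase hi)]
  rw [this]
  simp [Nat.factorial_succ]
  ring

theorem pairing_mul_X (v : V) (f g : MvPolynomial V ℝ) :
    pairing f (X v * g) = pairing (pderiv v f) g := by
  rw [pairing_comm, pairing_X_mul, pairing_comm]

theorem pairing_C_mul_right (r : ℝ) (f g : MvPolynomial V ℝ) :
    pairing f (C r * g) = r * pairing f g := by
  simp [C_mul']

theorem pairing_mul_sub (v u : V) (f g : MvPolynomial V ℝ) :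
    pairing f ((X v - X u) * g) = pairing (pderiv v f - pderiv u f) g := by
  rw [sub_mul, map_sub, pairing_mul_X, pairing_mul_X, map_sub, LinearMap.sub_apply]

/-- Serves to discard terms that still contain the newly added variable. -/
theorem pairing_X_mul_eq_zero {v : V} {g : MvPolynomial V ℝ} (h : pderiv v g = 0)
    (f : MvPolynomial V ℝ) : pairing (X v * f) g = 0 := by
  rw [pairing_X_mul, h, map_zero]

theorem pairing_X_pow_mul (v : V) (d : ℕ) (f g : MvPolynomial V ℝ) :
    pairing (X v ^ d * f) g = pairing f ((pderiv v)^[d] g) := by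
  induction d generalizing g with
  | zero => simp
  | succ d ih => rw [pow_succ', mul_assoc, pairing_X_mul, ih, Function.iterate_succ_apply]

end Pairing

/-! ### Iterated derivatives of products of linear forms. -/

section IteratedDerivative

variable {V : Type*}

/-- Leibniz's rule has only two terms here, as the second derivative of `l` vanishes. -/
theorem iterate_pderiv_mul {v : V} {l : MvPolynomial V ℝ} {c : ℝ} (hl : pderiv v l = C c)
    (k : ℕ) (r : MvPolynomial V ℝ) :
    (pderiv v)^[k + 1] (l * r) =
      l * (pderiv v)^[k + 1] r + C ((k + 1 : ℕ) * c) * (pderiv v)^[k] r := by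
  induction k with
  | zero => simp [hl, add_comm, mul_comm]
  | succ k ih =>
    rw [Function.iterate_succ_apply', ih, map_add, pderiv_mul, pderiv_C_mul, hl,
      ← Function.iterate_succ_apply' (pderiv v) (k + 1) r,
      ← Function.iterate_succ_apply' (pderiv v) k r]
    push_cast
    simp only [C_mul, C_add, C_1]
    ring

theorem iterate_pderiv_prod_mul {ι : Type*} {v : V} (F : Finset ι) {l : ι → MvPolynomial V ℝ}
    {c : ι → ℝ} (hl : ∀ i ∈ F, pderiv v (l i) = C (c i)) {g : MvPolynomial V ℝ}
    (hg : pderiv v g = 0) :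
    (pderiv v)^[F.card] ((∏ i ∈ F, l i) * g) = C (F.card.factorial * ∏ i ∈ F, c i) * g := by
  classical
  induction F using Finset.induction_on with
  | empty => simp
  | insert a F ha ih =>
    have ih := ih fun i hi => hl i (Finset.mem_insert_of_mem hi)
    rw [Finset.card_insert_of_notMem ha, Finset.prod_insert ha, Finset.prod_insert ha, mul_assoc,
      iterate_pderiv_mul (hl a (Finset.mem_insert_self _ _)), Function.iterate_succ_apply', ih,
      pderiv_C_mul, hg, Nat.factorial_succ]
    push_cast
    simp only [C_mul, C_add, C_1]
    ring

end IteratedDerivative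

/-! ### Connected vertex sets. -/

section Cut

variable {V : Type*} [DecidableEq V] (G : SimpleGraph V)

/-- The vertices of `W` induce a connected subgraph: every proper non-empty part of `W` is joined
to the rest of `W`. -/
def CutConnected (W : Finset V) : Prop :=
  W.Nonempty ∧ ∀ U ⊂ W, U.Nonempty → ∃ u ∈ U, ∃ w ∈ W, w ∉ U ∧ G.Adj u w

variable {G}

theorem cutConnected_singleton (a : V) : CutConnected G {a} := by
  refine ⟨Finset.singleton_nonempty a, fun U hU hne => ?_⟩
  rw [Finset.ssubset_singleton_iff] at hU
  exact absurd hU hne.ne_empty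

theorem CutConnected.insert {U : Finset V} (hU : CutConnected G U) {u w : V} (hu : u ∈ U)
    (h : G.Adj u w) : CutConnected G (insert w U) := by
  by_cases hw : w ∈ U
  · rwa [Finset.insert_eq_of_mem hw]
  refine ⟨Finset.insert_nonempty _ _, fun X hX hne => ?_⟩
  rcases (X ∩ U).eq_empty_or_nonempty with h0 | h0
  · obtain ⟨x, hx⟩ := hne
    have hxw : x = w := by
      rcases Finset.mem_insert.1 (hX.1 hx) with h1 | h1
      · exact h1
      · exact absurd (Finset.mem_inter.2 ⟨hx, h1⟩) (by simp [h0])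
    refine ⟨x, hx, u, Finset.mem_insert_of_mem hu, fun huX => ?_, hxw ▸ h.symm⟩
    exact absurd (Finset.mem_inter.2 ⟨huX, hu⟩) (by simp [h0])
  by_cases h1 : X ∩ U = U
  · have hUX : U ⊆ X := Finset.inter_eq_right.1 h1
    refine ⟨u, hUX hu, w, Finset.mem_insert_self _ _, fun hwX => ?_, h⟩
    exact hX.2 (Finset.insert_subset hwX hUX)
  · obtain ⟨x, hx, y, hy, hyX, hxy⟩ :=
      hU.2 (X ∩ U) (Finset.ssubset_iff_subset_ne.2 ⟨Finset.inter_subset_right, h1⟩) h0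
    rw [Finset.mem_inter] at hx hyX
    exact ⟨x, hx.1, y, Finset.mem_insert_of_mem hy, fun h2 => hyX ⟨h2, hy⟩, hxy⟩

/-- A connected set with at least two vertices has a vertex other than `a` whose removal leaves a
connected set. -/
theorem CutConnected.exists_insert {W : Finset V} (hW : CutConnected G W) {a : V} (ha : a ∈ W)
    (hne : W ≠ {a}) :
    ∃ v W', v ∉ W' ∧ W = Insert.insert v W' ∧ a ∈ W' ∧ CutConnected G W' ∧
      ∃ u ∈ W', G.Adj v u := by
  classical
  -- A largest proper connected subset containing `a` misses exactly one vertex: otherwise a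
  -- boundary edge would enlarge it.
  let 𝒰 := W.ssubsets.filter fun U => a ∈ U ∧ CutConnected G U
  have h𝒰 : 𝒰.Nonempty := ⟨{a}, by
    simp only [𝒰, Finset.mem_filter, Finset.mem_ssubsets, Finset.mem_singleton, true_and]
    exact ⟨Finset.ssubset_iff_subset_ne.2 ⟨Finset.singleton_subset_iff.2 ha, hne.symm⟩,
      cutConnected_singleton a⟩⟩
  obtain ⟨U, hU, hmax⟩ := 𝒰.exists_max_image Finset.card h𝒰
  simp only [𝒰, Finset.mem_filter, Finset.mem_ssubsets] at hU hmax
  obtain ⟨u, hu, w, hw, hwU, huw⟩ := hW.2 U hU.1 ⟨a, hU.2.1⟩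
  refine ⟨w, U, hwU, ?_, hU.2.1, hU.2.2, u, hu, huw.symm⟩
  by_contra hWU
  have := hmax (Insert.insert w U) ⟨Finset.ssubset_iff_subset_ne.2
    ⟨Finset.insert_subset hw hU.1.1, Ne.symm hWU⟩, Finset.mem_insert_of_mem hU.2.1,
    hU.2.2.insert hu huw⟩
  rw [Finset.card_insert_of_notMem hwU] at this
  omega

theorem cutConnected_univ [Fintype V] (h : G.Connected) : CutConnected G Finset.univ := by
  obtain ⟨a⟩ := h.nonempty
  refine ⟨⟨a, Finset.mem_univ a⟩, fun U hU hne => ?_⟩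
  obtain ⟨u, hu⟩ := hne
  obtain ⟨w, -, hw⟩ := Finset.exists_of_ssubset hU
  obtain ⟨p⟩ := h.preconnected u w
  obtain ⟨d, -, hd₁, hd₂⟩ := p.exists_boundary_dart (U : Set V) hu hw
  exact ⟨d.fst, hd₁, d.snd, Finset.mem_univ _, hd₂, d.adj⟩

end Cut

/-! ### Graph polynomials and the addition of a vertex. -/

section Oriented

variable {V : Type*} [Fintype V] [DecidableEq V] {G : SimpleGraph V} [DecidableRel G.Adj]
  (D : Orientation G)

/-- The linear form `x_head - x_tail` of an edge. -/
noncomputable def edgeForm (e : G.edgeSet) : MvPolynomial V ℝ := X (D.head e) - X (D.tail e)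

/-- The linear form `x_v` of a vertex `v`, and `x_u + x_v` of an edge `uv`. -/
noncomputable def elementForm : V ⊕ G.edgeSet → MvPolynomial V ℝ
  | Sum.inl v => X v
  | Sum.inr e => X (D.head e) + X (D.tail e)

/-- The edges with both ends in `W`. -/
def edgesIn (W : Finset V) : Finset G.edgeSet :=
  Finset.univ.filter fun e => D.head e ∈ W ∧ D.tail e ∈ W

/-- The product of the forms `x_head - x_tail` over the edges inside `W`. -/
noncomputable def graphPoly (W : Finset V) : MvPolynomial V ℝ := ∏ e ∈ edgesIn D W, edgeForm D e

/-- The edges with both ends in `insert v W`, but not in `W`. -/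
def star (v : V) (W : Finset V) : Finset G.edgeSet := edgesIn D (insert v W) \ edgesIn D W

/-- A vertex of `W` or an edge inside `W`. -/
def Inside (W : Finset V) : V ⊕ G.edgeSet → Prop
  | Sum.inl v => v ∈ W
  | Sum.inr e => D.head e ∈ W ∧ D.tail e ∈ W

/-- The product of the linear forms of the elements of `S`. -/
noncomputable def setForm (S : Finset (V ⊕ G.edgeSet)) : MvPolynomial V ℝ :=
  ∏ z ∈ S, elementForm D z

/-- `S` is a set of vertices and edges of the subgraph induced by `W` whose form is not
orthogonal to the polynomial of that subgraph. -/
structure IsGood (W : Finset V) (S : Finset (V ⊕ G.edgeSet)) : Prop where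
  inside : ∀ z ∈ S, Inside D W z
  ne_zero : pairing (setForm D S) (graphPoly D W) ≠ 0

variable {D}

theorem Orientation.adj (e : G.edgeSet) : G.Adj (D.tail e) (D.head e) := by
  have := e.2
  rwa [D.ends e, SimpleGraph.mem_edgeSet] at this

theorem head_tail_of_eq {e : G.edgeSet} {v u : V} (h : (e : Sym2 V) = s(v, u)) :
    D.head e = v ∧ D.tail e = u ∨ D.head e = u ∧ D.tail e = v := by
  rw [D.ends e, Sym2.eq_iff] at h
  tauto

theorem edgeForm_of_eq {e : G.edgeSet} {v u : V} (h : (e : Sym2 V) = s(v, u)) :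
    ∃ c : ℝ, c ≠ 0 ∧ edgeForm D e = C c * (X v - X u) := by
  rcases head_tail_of_eq (D := D) h with ⟨h₁, h₂⟩ | ⟨h₁, h₂⟩
  · exact ⟨1, one_ne_zero, by simp [edgeForm, h₁, h₂]⟩
  · exact ⟨-1, by norm_num, by simp [edgeForm, h₁, h₂]⟩

theorem elementForm_of_eq {e : G.edgeSet} {v u : V} (h : (e : Sym2 V) = s(v, u)) :
    elementForm D (Sum.inr e) = X v + X u := by
  rcases head_tail_of_eq (D := D) h with ⟨h₁, h₂⟩ | ⟨h₁, h₂⟩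
  · simp [elementForm, h₁, h₂]
  · simp [elementForm, h₁, h₂, add_comm]

theorem inside_of_eq {e : G.edgeSet} {v u : V} (h : (e : Sym2 V) = s(v, u)) {W : Finset V} :
    Inside D W (Sum.inr e) ↔ v ∈ W ∧ u ∈ W := by
  rcases head_tail_of_eq (D := D) h with ⟨h₁, h₂⟩ | ⟨h₁, h₂⟩
  · simp [Inside, h₁, h₂]
  · simp [Inside, h₁, h₂, and_comm]

theorem Inside.mono {W W' : Finset V} (h : W' ⊆ W) {z : V ⊕ G.edgeSet} (hz : Inside D W' z) :
    Inside D W z := by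
  cases z with
  | inl v => exact h hz
  | inr e => exact ⟨h hz.1, h hz.2⟩

theorem pderiv_prod_eq_zero {ι : Type*} {v : V} (F : Finset ι) {l : ι → MvPolynomial V ℝ}
    (h : ∀ i ∈ F, pderiv v (l i) = 0) : pderiv v (∏ i ∈ F, l i) = 0 := by
  refine Finset.prod_induction l (fun p => pderiv v p = 0) (fun p q hp hq => ?_) pderiv_one h
  simp only [pderiv_mul, hp, hq, zero_mul, mul_zero, add_zero]

theorem pderiv_prod_X {v : V} {W : Finset V} (hv : v ∉ W) :
    pderiv v (∏ w ∈ W, X w : MvPolynomial V ℝ) = 0 :=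
  pderiv_prod_eq_zero _ fun _ hw => pderiv_X_of_ne (ne_of_mem_of_not_mem hw hv)

theorem pderiv_graphPoly {v : V} {W : Finset V} (hv : v ∉ W) : pderiv v (graphPoly D W) = 0 := by
  refine pderiv_prod_eq_zero _ fun e he => ?_
  simp only [edgesIn, Finset.mem_filter] at he
  simp [edgeForm, pderiv_X_of_ne (ne_of_mem_of_not_mem he.2.1 hv),
    pderiv_X_of_ne (ne_of_mem_of_not_mem he.2.2 hv)]

theorem edgesIn_mono {W W' : Finset V} (h : W' ⊆ W) : edgesIn D W' ⊆ edgesIn D W := by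
  intro e he
  simp only [edgesIn, Finset.mem_filter] at he ⊢
  exact ⟨he.1, h he.2.1, h he.2.2⟩

theorem card_edgesIn_insert (v : V) (W : Finset V) :
    (edgesIn D (insert v W)).card = (star D v W).card + (edgesIn D W).card :=
  (Finset.card_sdiff_add_card_eq_card (edgesIn_mono (Finset.subset_insert v W))).symm

theorem graphPoly_insert (v : V) (W : Finset V) :
    graphPoly D (insert v W) = (∏ e ∈ star D v W, edgeForm D e) * graphPoly D W :=
  (Finset.prod_sdiff (edgesIn_mono (Finset.subset_insert v W))).symm

theorem mem_star {v : V} {W : Finset V} (hv : v ∉ W) {e : G.edgeSet} :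
    e ∈ star D v W ↔ ∃ u ∈ W, (e : Sym2 V) = s(v, u) := by
  constructor
  · intro he
    have hne := (D.adj e).ne
    simp only [star, edgesIn, Finset.mem_sdiff, Finset.mem_filter, Finset.mem_univ, true_and,
      Finset.mem_insert] at he
    obtain ⟨⟨h₁ | h₁, h₂ | h₂⟩, h₃⟩ := he
    · exact absurd (h₂.trans h₁.symm) hne
    · exact ⟨_, h₂, by rw [D.ends e, ← h₁, Sym2.eq_swap]⟩
    · exact ⟨_, h₁, by rw [D.ends e, ← h₂]⟩
    · exact absurd ⟨h₁, h₂⟩ h₃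
  · rintro ⟨u, hu, h⟩
    have h₁ := (inside_of_eq (D := D) (W := insert v W) h).2
      ⟨Finset.mem_insert_self v W, Finset.mem_insert_of_mem hu⟩
    have h₂ := mt (inside_of_eq (D := D) (W := W) h).1 fun h => hv h.1
    simp only [Inside] at h₁ h₂
    simp only [star, edgesIn, Finset.mem_sdiff, Finset.mem_filter, Finset.mem_univ, true_and]
    exact ⟨h₁, h₂⟩

theorem exists_edge {v u : V} (h : G.Adj v u) : ∃ e : G.edgeSet, (e : Sym2 V) = s(v, u) :=
  ⟨⟨s(v, u), h⟩, rfl⟩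

theorem adj_of_eq {e : G.edgeSet} {v u : V} (h : (e : Sym2 V) = s(v, u)) : G.Adj v u := by
  have := e.2
  rwa [h, SimpleGraph.mem_edgeSet] at this

theorem star_card_pos {v : V} {W : Finset V} (hv : v ∉ W) (h : ∃ u ∈ W, G.Adj v u) :
    0 < (star D v W).card := by
  obtain ⟨u, hu, hvu⟩ := h
  obtain ⟨e, he⟩ := exists_edge hvu
  exact Finset.card_pos.2 ⟨e, (mem_star hv).2 ⟨u, hu, he⟩⟩

theorem eq_of_ends_eq {e f : G.edgeSet} {v u : V} (he : (e : Sym2 V) = s(v, u))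
    (hf : (f : Sym2 V) = s(v, u)) : e = f := Subtype.ext (he.trans hf.symm)

theorem ends_ne_of_ne {e f : G.edgeSet} {v u w : V} (he : (e : Sym2 V) = s(v, u))
    (hf : (f : Sym2 V) = s(v, w)) (h : e ≠ f) : u ≠ w := by
  rintro rfl
  exact h (eq_of_ends_eq he hf)

/-- Each vertex added to a connected set brings at least one edge. In the inductions this bounds the
degree of the removed vertex. -/
theorem CutConnected.card_le {W : Finset V} (hW : CutConnected G W) :
    W.card ≤ (edgesIn D W).card + 1 := by
  induction hn : W.card generalizing W with
  | zero => omega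
  | succ n ih =>
    obtain ⟨a, ha⟩ := hW.1
    by_cases h : W = {a}
    · subst h
      simp at hn
      omega
    obtain ⟨v, W', hv, rfl, -, hW', hadj⟩ := hW.exists_insert ha h
    rw [Finset.card_insert_of_notMem hv] at hn
    have := ih hW' (by omega)
    have := star_card_pos (D := D) hv hadj
    rw [card_edgesIn_insert]
    omega

/-- A product with a power of a new variable is not orthogonal to the polynomial of the enlarged
graph. -/
theorem pairing_X_pow_ne_zero {v : V} {W : Finset V} (hv : v ∉ W) {Q : MvPolynomial V ℝ}
    (hQ : pairing Q (graphPoly D W) ≠ 0) :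
    pairing (X v ^ (star D v W).card * Q) (graphPoly D (insert v W)) ≠ 0 := by
  have h : ∀ e ∈ star D v W, ∃ c : ℝ, c ≠ 0 ∧ pderiv v (edgeForm D e) = C c := fun e he => by
    obtain ⟨u, hu, h⟩ := (mem_star hv).1 he
    obtain ⟨c, hc, h⟩ := edgeForm_of_eq (D := D) h
    refine ⟨c, hc, ?_⟩
    rw [h, pderiv_C_mul, map_sub, pderiv_X_self, pderiv_X_of_ne (ne_of_mem_of_not_mem hu hv)]
    simp
  choose! c hc h using h
  rw [pairing_X_pow_mul, graphPoly_insert, iterate_pderiv_prod_mul _ h (pderiv_graphPoly hv),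
    pairing_C_mul_right]
  exact mul_ne_zero (mul_ne_zero (Nat.cast_ne_zero.2 (Nat.factorial_ne_zero _))
    (Finset.prod_ne_zero_iff.2 hc)) hQ

theorem graphPoly_insert_of_card_eq_one {v : V} {W : Finset V} (hv : v ∉ W)
    (h : (star D v W).card = 1) :
    ∃ (u : V) (e : G.edgeSet) (c : ℝ), u ∈ W ∧ (e : Sym2 V) = s(v, u) ∧ c ≠ 0 ∧
      (∀ w ∈ W, G.Adj v w → w = u) ∧
      graphPoly D (insert v W) = C c * ((X v - X u) * graphPoly D W) := by
  obtain ⟨e, he⟩ := Finset.card_eq_one.1 h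
  obtain ⟨u, hu, heu⟩ := (mem_star (D := D) hv (e := e)).1 (by simp [he])
  obtain ⟨c, hc, hec⟩ := edgeForm_of_eq (D := D) heu
  refine ⟨u, e, c, hu, heu, hc, fun w hw hvw => ?_, ?_⟩
  · obtain ⟨f, hf⟩ := exists_edge hvw
    have hfs : f ∈ star D v W := (mem_star hv).2 ⟨w, hw, hf⟩
    rw [he, Finset.mem_singleton] at hfs
    subst hfs
    exact Sym2.congr_right.1 (hf.symm.trans heu)
  · rw [graphPoly_insert, he, Finset.prod_singleton, hec, mul_assoc]

theorem graphPoly_insert_of_card_eq_two {v : V} {W : Finset V} (hv : v ∉ W)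
    (h : (star D v W).card = 2) :
    ∃ (b c : V) (e f : G.edgeSet) (r : ℝ), b ∈ W ∧ c ∈ W ∧ b ≠ c ∧ e ≠ f ∧
      (e : Sym2 V) = s(v, b) ∧ (f : Sym2 V) = s(v, c) ∧ r ≠ 0 ∧
      graphPoly D (insert v W) = C r * ((X v - X b) * ((X v - X c) * graphPoly D W)) := by
  obtain ⟨e, f, hef, he⟩ := Finset.card_eq_two.1 h
  obtain ⟨b, hb, heb⟩ := (mem_star (D := D) hv (e := e)).1 (by simp [he])
  obtain ⟨c, hc, hfc⟩ := (mem_star (D := D) hv (e := f)).1 (by simp [he])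
  obtain ⟨r, hr, her⟩ := edgeForm_of_eq (D := D) heb
  obtain ⟨t, ht, hft⟩ := edgeForm_of_eq (D := D) hfc
  refine ⟨b, c, e, f, r * t, hb, hc, ends_ne_of_ne heb hfc hef, hef, heb, hfc,
    mul_ne_zero hr ht, ?_⟩
  rw [graphPoly_insert, he, Finset.prod_pair hef, her, hft, C_mul]
  ring

/-- Since `x_v = (x_v + x_u) - x_u`, a factor `x_v` can be exchanged. -/
theorem pairing_exchange {e : G.edgeSet} {v u : V} (h : (e : Sym2 V) = s(v, u))
    {Q P : MvPolynomial V ℝ} (hQ : pairing (X v * Q) P ≠ 0) :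
    pairing (elementForm D (Sum.inr e) * Q) P ≠ 0 ∨
      pairing (elementForm D (Sum.inl u) * Q) P ≠ 0 := by
  by_contra! hcon
  apply hQ
  have : X v * Q = elementForm D (Sum.inr e) * Q - elementForm D (Sum.inl u) * Q := by
    rw [elementForm_of_eq h, elementForm]
    ring
  rw [this, map_sub, LinearMap.sub_apply, hcon.1, hcon.2, sub_zero]

end Oriented

/-! ### Good sets in trees, and their extension by a vertex. -/

section Tree

variable {V : Type*} [Fintype V] [DecidableEq V] {G : SimpleGraph V} [DecidableRel G.Adj]
  {D : Orientation G}

theorem setForm_insert {S : Finset (V ⊕ G.edgeSet)} {z : V ⊕ G.edgeSet} (hz : z ∉ S) :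
    setForm D (insert z S) = elementForm D z * setForm D S := Finset.prod_insert hz

theorem setForm_image_inl (W : Finset V) :
    setForm D (W.image Sum.inl) = ∏ w ∈ W, X w := by
  rw [setForm, Finset.prod_image fun _ _ _ _ h => Sum.inl_injective h]
  rfl

theorem notMem_of_inside {v : V} {W : Finset V} (hv : v ∉ W) {S : Finset (V ⊕ G.edgeSet)}
    (hS : ∀ z ∈ S, Inside D W z) : Sum.inl v ∉ S := fun h => hv (hS _ h)

theorem edge_notMem_of_inside {v u : V} {W : Finset V} (hv : v ∉ W) {e : G.edgeSet}
    (he : (e : Sym2 V) = s(v, u)) {S : Finset (V ⊕ G.edgeSet)}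
    (hS : ∀ z ∈ S, Inside D W z) : Sum.inr e ∉ S :=
  fun h => hv ((inside_of_eq he).1 (hS _ h)).1

theorem inside_insert {v : V} {W : Finset V} {S : Finset (V ⊕ G.edgeSet)}
    (hS : ∀ z ∈ S, Inside D W z) : ∀ z ∈ S, Inside D (insert v W) z :=
  fun z hz => (hS z hz).mono (Finset.subset_insert v W)

theorem inside_edge {v u : V} {W : Finset V} (hu : u ∈ W) {e : G.edgeSet}
    (he : (e : Sym2 V) = s(v, u)) : Inside D (insert v W) (Sum.inr e) :=
  (inside_of_eq he).2 ⟨Finset.mem_insert_self v W, Finset.mem_insert_of_mem hu⟩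

theorem IsGood.insert_leaf {v : V} {W : Finset V} {S : Finset (V ⊕ G.edgeSet)}
    (hS : IsGood D W S) (hv : v ∉ W) (hd : (star D v W).card = 1) :
    IsGood D (insert v W) (insert (Sum.inl v) S) := by
  refine ⟨Finset.forall_mem_insert _ _ _ |>.2
    ⟨Finset.mem_insert_self v W, inside_insert hS.inside⟩, ?_⟩
  have := pairing_X_pow_ne_zero hv hS.ne_zero
  rw [hd, pow_one] at this
  rwa [setForm_insert (notMem_of_inside hv hS.inside)]

/-- A connected graph with one edge less than vertices. -/
def IsTreeOn (D : Orientation G) (W : Finset V) : Prop :=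
  CutConnected G W ∧ (edgesIn D W).card + 1 = W.card

theorem IsTreeOn.exists_leaf {W : Finset V} (hW : IsTreeOn D W) {a : V} (ha : a ∈ W)
    (hne : W ≠ {a}) :
    ∃ v W', v ∉ W' ∧ W = insert v W' ∧ a ∈ W' ∧ IsTreeOn D W' ∧ (star D v W').card = 1 := by
  obtain ⟨v, W', hv, rfl, haW, hW', hadj⟩ := hW.1.exists_insert ha hne
  have h₁ := hW.2
  have h₂ := hW'.card_le (D := D)
  have h₃ := star_card_pos (D := D) hv hadj
  rw [card_edgesIn_insert, Finset.card_insert_of_notMem hv] at h₁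
  exact ⟨v, W', hv, rfl, haW, ⟨hW', by omega⟩, by omega⟩

/-- The coefficient in the graph polynomial of the product of all vertices but `b`. -/
noncomputable def coeffErase (D : Orientation G) (W : Finset V) (b : V) : ℝ :=
  pairing (∏ w ∈ W.erase b, X w) (graphPoly D W)

theorem coeffErase_insert {v u : V} {W : Finset V} {c : ℝ} (hv : v ∉ W) (hu : u ∈ W)
    (hP : graphPoly D (insert v W) = C c * ((X v - X u) * graphPoly D W)) {b : V} (hb : b ∈ W) :
    coeffErase D (insert v W) b = c * coeffErase D W b := by
  have hvb : v ≠ b := (ne_of_mem_of_not_mem hb hv).symm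
  have hvu : v ≠ u := (ne_of_mem_of_not_mem hu hv).symm
  have hv' : v ∉ W.erase b := fun h => hv (Finset.mem_of_mem_erase h)
  rw [coeffErase, Finset.erase_insert_of_ne hvb, Finset.prod_insert hv', hP,
    pairing_C_mul_right, pairing_mul_sub, pderiv_mul, pderiv_mul, pderiv_prod_X hv',
    pderiv_X_self, pderiv_X_of_ne hvu, one_mul, mul_zero, add_zero, zero_mul, zero_add, map_sub,
    LinearMap.sub_apply, pairing_X_mul_eq_zero (pderiv_graphPoly hv), sub_zero, coeffErase]

/-- The monomial now lacks `x_v`, so the factor `x_v - x_u` must supply `-x_u`; hence the sign. -/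
theorem coeffErase_insert_self {v u : V} {W : Finset V} {c : ℝ} (hv : v ∉ W) (hu : u ∈ W)
    (hP : graphPoly D (insert v W) = C c * ((X v - X u) * graphPoly D W)) :
    coeffErase D (insert v W) v = -(c * coeffErase D W u) := by
  rw [coeffErase, Finset.erase_insert hv, hP, pairing_C_mul_right, pairing_mul_sub,
    pderiv_prod_X hv, ← Finset.mul_prod_erase _ _ hu, pderiv_mul, pderiv_X_self,
    pderiv_prod_X (Finset.notMem_erase u W), one_mul, mul_zero, add_zero, zero_sub, map_neg,
    LinearMap.neg_apply, mul_neg, coeffErase]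

/-- Only one term of the expansion contributes: every edge supplies its end farther from `b`. Leaves
are peeled off to prove it. -/
theorem IsTreeOn.coeffErase_ne_zero {W : Finset V} (hW : IsTreeOn D W) {b : V} (hb : b ∈ W) :
    coeffErase D W b ≠ 0 := by
  induction hn : W.card generalizing W with
  | zero => simp_all
  | succ n ih =>
    by_cases hne : W = {b}
    · subst hne
      have h : edgesIn D {b} = ∅ := by
        have := hW.2
        simpa using this
      simp [coeffErase, graphPoly, h, pairing_one]
    obtain ⟨v, W', hv, rfl, hbW, hW', hd⟩ := hW.exists_leaf hb hne
    obtain ⟨u, e, c, hu, -, hc, -, hP⟩ := graphPoly_insert_of_card_eq_one hv hd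
    rw [coeffErase_insert hv hu hP hbW]
    rw [Finset.card_insert_of_notMem hv] at hn
    exact mul_ne_zero hc (ih hW' hbW (by omega))

/-- Moving the root from `b` to `c` changes the end supplied by the edge `bc` only. -/
theorem IsTreeOn.coeffErase_adj {W : Finset V} (hW : IsTreeOn D W) {b c : V} (hb : b ∈ W)
    (hc : c ∈ W) (h : G.Adj b c) : coeffErase D W c = -coeffErase D W b := by
  induction hn : W.card generalizing W with
  | zero => simp_all
  | succ n ih =>
    by_cases hne : W = {b}
    · subst hne
      exact absurd (Finset.mem_singleton.1 hc).symm h.ne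
    obtain ⟨v, W', hv, rfl, hbW, hW', hd⟩ := hW.exists_leaf hb hne
    obtain ⟨u, e, r, hu, -, hr, hadj, hP⟩ := graphPoly_insert_of_card_eq_one hv hd
    rw [Finset.card_insert_of_notMem hv] at hn
    rw [coeffErase_insert hv hu hP hbW]
    rcases Finset.mem_insert.1 hc with rfl | hcW
    · obtain rfl := hadj b hbW h.symm
      rw [coeffErase_insert_self hv hu hP]
    · rw [coeffErase_insert hv hu hP hcW, ih hW' hbW hcW (by omega), mul_neg]

/-- Signs cannot alternate around a triangle. -/
theorem IsTreeOn.no_triangle {W : Finset V} (hW : IsTreeOn D W) {a b c : V} (ha : a ∈ W)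
    (hb : b ∈ W) (hc : c ∈ W) (hab : G.Adj a b) (hac : G.Adj a c) : ¬ G.Adj b c := by
  intro hbc
  have h₁ := hW.coeffErase_adj ha hb hab
  have h₂ := hW.coeffErase_adj ha hc hac
  have h₃ := hW.coeffErase_adj hb hc hbc
  exact hW.coeffErase_ne_zero ha (by linarith)

/-- In a tree there is a good set that avoids two given non-adjacent vertices. -/
theorem IsTreeOn.exists_isGood {W : Finset V} (hW : IsTreeOn D W) {a b : V} (ha : a ∈ W)
    (hb : b ∈ W) (hab : a ≠ b) (h : ¬ G.Adj a b) :
    ∃ S, IsGood D W S ∧ Sum.inl a ∉ S ∧ Sum.inl b ∉ S := by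
  induction hn : W.card generalizing W with
  | zero => simp_all
  | succ n ih =>
    have hne : W ≠ {b} := by
      rintro rfl
      exact hab (Finset.mem_singleton.1 ha)
    obtain ⟨v, W', hv, rfl, hbW, hW', hd⟩ := hW.exists_leaf hb hne
    rw [Finset.card_insert_of_notMem hv] at hn
    rcases Finset.mem_insert.1 ha with rfl | haW
    · obtain ⟨u, e, c, hu, he, hc, -, hP⟩ := graphPoly_insert_of_card_eq_one hv hd
      have hub : u ≠ b := by
        rintro rfl
        exact h (adj_of_eq he)
      have hau : a ≠ u := (ne_of_mem_of_not_mem hu hv).symm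
      have hub' : u ∈ W'.erase b := Finset.mem_erase.2 ⟨hub, hu⟩
      have hav : a ∉ W'.erase b := fun h => hv (Finset.mem_of_mem_erase h)
      -- The leaf is `a` itself, so its edge `au` takes its place, together with all vertices of
      -- `W'` but `b`; here `u ≠ b` because `a` and `b` are not adjacent.
      refine ⟨insert (Sum.inr e) ((W'.erase b).image Sum.inl), ⟨?_, ?_⟩, ?_, ?_⟩
      · rw [Finset.forall_mem_insert]
        refine ⟨inside_edge hu he, fun z hz => ?_⟩
        obtain ⟨w, hw, rfl⟩ := Finset.mem_image.1 hz
        exact Finset.mem_insert_of_mem (Finset.mem_of_mem_erase hw)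
      · rw [setForm_insert (by simp), setForm_image_inl, elementForm_of_eq he, hP,
          pairing_C_mul_right, pairing_mul_sub]
        have ht := hW'.coeffErase_ne_zero hbW
        rw [coeffErase] at ht
        have h₁ := pderiv_prod_X hav
        have h₂ := pderiv_prod_X (Finset.notMem_erase u (W'.erase b))
        rw [← Finset.mul_prod_erase _ _ hub'] at h₁ ht ⊢
        set m : MvPolynomial V ℝ := ∏ w ∈ (W'.erase b).erase u, X w
        have : pderiv a ((X a + X u) * (X u * m)) - pderiv u ((X a + X u) * (X u * m)) =
            X a * (-m) - X u * m := by
          rw [pderiv_mul, h₁]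
          simp only [pderiv_mul, map_add, pderiv_X_self, pderiv_X_of_ne hau,
            pderiv_X_of_ne hau.symm, h₂]
          ring
        rw [this, map_sub, LinearMap.sub_apply, pairing_X_mul_eq_zero (pderiv_graphPoly hv),
          zero_sub]
        exact mul_ne_zero hc (neg_ne_zero.2 ht)
      · simpa using fun _ h => hv h
      · simp
    · obtain ⟨S, hS, haS, hbS⟩ := ih hW' haW hbW (by omega)
      refine ⟨insert (Sum.inl v) S, hS.insert_leaf hv hd, ?_, ?_⟩
      · simpa [haS] using ne_of_mem_of_not_mem haW hv
      · simpa [hbS] using ne_of_mem_of_not_mem hbW hv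

/-- `R` holds the factors `x_v` still to be used. As neither `f` nor `c` lies in `S`, the product of
the forms of `S` stays squarefree after the trade. -/
theorem IsGood.exchange {v c : V} {W : Finset V} {S : Finset (V ⊕ G.edgeSet)}
    {f : G.edgeSet} (hf : (f : Sym2 V) = s(v, c)) (hcW : c ∈ W)
    (hS : ∀ z ∈ S, Inside D (insert v W) z) (hfS : Sum.inr f ∉ S) (hcS : Sum.inl c ∉ S)
    {R : MvPolynomial V ℝ}
    (h : pairing (X v * (R * setForm D S)) (graphPoly D (insert v W)) ≠ 0) :
    ∃ z, (z = Sum.inr f ∨ z = Sum.inl c) ∧ (∀ y ∈ insert z S, Inside D (insert v W) y) ∧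
      pairing (R * setForm D (insert z S)) (graphPoly D (insert v W)) ≠ 0 := by
  rcases pairing_exchange hf h with h | h
  · refine ⟨_, Or.inl rfl, Finset.forall_mem_insert _ _ _ |>.2 ⟨inside_edge hcW hf, hS⟩, ?_⟩
    rwa [setForm_insert hfS, mul_left_comm]
  · refine ⟨_, Or.inr rfl, Finset.forall_mem_insert _ _ _ |>.2
      ⟨Finset.mem_insert_of_mem hcW, hS⟩, ?_⟩
    rwa [setForm_insert hcS, mul_left_comm]

/-- One factor of `x_v ^ 2` is kept as the vertex `v`, the other is traded along `f`. The control on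
the vertices of `S'` shows which ones remain free. -/
theorem IsGood.extend_two {v c : V} {W : Finset V} {S : Finset (V ⊕ G.edgeSet)}
    (hS : IsGood D W S) (hv : v ∉ W) (hd : (star D v W).card = 2) {f : G.edgeSet}
    (hf : (f : Sym2 V) = s(v, c)) (hcW : c ∈ W) (hcS : Sum.inl c ∉ S) :
    ∃ S', IsGood D (insert v W) S' ∧
      ∀ x, Sum.inl x ∈ S' → x = v ∨ x = c ∨ Sum.inl x ∈ S := by
  have h := pairing_X_pow_ne_zero hv hS.ne_zero
  rw [hd, pow_two, mul_assoc] at h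
  obtain ⟨z, hz, hin, h⟩ := IsGood.exchange hf hcW (inside_insert hS.inside)
    (edge_notMem_of_inside hv hf hS.inside) hcS h
  have hvc : v ≠ c := (adj_of_eq hf).ne
  have hvz : Sum.inl v ∉ insert z S := by
    rw [Finset.mem_insert, not_or]
    refine ⟨?_, notMem_of_inside hv hS.inside⟩
    rcases hz with rfl | rfl <;> simp [hvc]
  refine ⟨insert (Sum.inl v) (insert z S), ⟨Finset.forall_mem_insert _ _ _ |>.2
    ⟨Finset.mem_insert_self v W, hin⟩, ?_⟩, fun x hx => ?_⟩
  · rwa [setForm_insert hvz]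
  · simp only [Finset.mem_insert, Sum.inl.injEq] at hx
    rcases hz with rfl | rfl <;> simp at hx <;> tauto

/-- Two factors of `x_v ^ 3` are traded, along different edges, so two free neighbours are needed.
-/
theorem IsGood.extend_three {v b c : V} {W : Finset V} {S : Finset (V ⊕ G.edgeSet)}
    (hS : IsGood D W S) (hv : v ∉ W) (hd : (star D v W).card = 3) {e f : G.edgeSet}
    (he : (e : Sym2 V) = s(v, b)) (hf : (f : Sym2 V) = s(v, c)) (hef : e ≠ f) (hbW : b ∈ W)
    (hcW : c ∈ W) (hbS : Sum.inl b ∉ S) (hcS : Sum.inl c ∉ S) :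
    ∃ S', IsGood D (insert v W) S' := by
  have h := pairing_X_pow_ne_zero hv hS.ne_zero
  have hbc : b ≠ c := ends_ne_of_ne he hf hef
  rw [hd, show X v ^ 3 * setForm D S = X v * ((X v * X v) * setForm D S) by ring] at h
  obtain ⟨z, hz, hin, h⟩ := IsGood.exchange he hbW (inside_insert hS.inside)
    (edge_notMem_of_inside hv he hS.inside) hbS h
  rw [mul_assoc] at h
  obtain ⟨y, hy, hin, h⟩ := IsGood.exchange hf hcW hin (by
      rw [Finset.mem_insert, not_or]
      refine ⟨?_, edge_notMem_of_inside hv hf hS.inside⟩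
      rcases hz with rfl | rfl <;> simp [hef.symm]) (by
      rw [Finset.mem_insert, not_or]
      refine ⟨?_, hcS⟩
      rcases hz with rfl | rfl <;> simp [hbc.symm]) h
  have hvc : v ≠ c := (adj_of_eq hf).ne
  have hvb : v ≠ b := (adj_of_eq he).ne
  have hvz : Sum.inl v ∉ insert y (insert z S) := by
    rw [Finset.mem_insert, not_or, Finset.mem_insert, not_or]
    refine ⟨?_, ?_, notMem_of_inside hv hS.inside⟩
    · rcases hy with rfl | rfl <;> simp [hvc]
    · rcases hz with rfl | rfl <;> simp [hvb]
  refine ⟨insert (Sum.inl v) (insert y (insert z S)), Finset.forall_mem_insert _ _ _ |>.2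
    ⟨Finset.mem_insert_self v W, hin⟩, ?_⟩
  rwa [setForm_insert hvz]

end Tree

/-! ### Good sets in unicyclic and bicyclic graphs. -/

section Cycles

variable {V : Type*} [Fintype V] [DecidableEq V] {G : SimpleGraph V} [DecidableRel G.Adj]
  {D : Orientation G}

theorem inside_image_erase (v a : V) (W : Finset V) :
    ∀ z ∈ (W.erase a).image Sum.inl, Inside D (insert v W) z := by
  intro z hz
  obtain ⟨w, hw, rfl⟩ := Finset.mem_image.1 hz
  exact Finset.mem_insert_of_mem (Finset.mem_of_mem_erase hw)

/-- A tree with a new vertex joined to the ends of an edge `ac`. -/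
theorem IsTreeOn.exists_isGood_triangle {v a c : V} {W : Finset V} (hW : IsTreeOn D W)
    (hv : v ∉ W) (ha : a ∈ W) (hc : c ∈ W) (hac : G.Adj a c) {e : G.edgeSet}
    (he : (e : Sym2 V) = s(v, a)) {r : ℝ} (hr : r ≠ 0)
    (hP : graphPoly D (insert v W) = C r * ((X v - X a) * ((X v - X c) * graphPoly D W))) :
    ∃ S, IsGood D (insert v W) S ∧ Sum.inl a ∉ S := by
  have hva : v ≠ a := (ne_of_mem_of_not_mem ha hv).symm
  have hvc : v ≠ c := (ne_of_mem_of_not_mem hc hv).symm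
  have hca : c ∈ W.erase a := Finset.mem_erase.2 ⟨hac.ne', hc⟩
  have hac' : a ∈ W.erase c := Finset.mem_erase.2 ⟨hac.ne, ha⟩
  refine ⟨insert (Sum.inl v) (insert (Sum.inr e) ((W.erase a).image Sum.inl)), ⟨?_, ?_⟩, ?_⟩
  · rw [Finset.forall_mem_insert, Finset.forall_mem_insert]
    exact ⟨Finset.mem_insert_self v W, inside_edge ha he, inside_image_erase v a W⟩
  · rw [setForm_insert (by simp [hv]), setForm_insert (by simp), setForm_image_inl,
      elementForm_of_eq he, hP, pairing_C_mul_right, pairing_mul_sub, pairing_mul_sub]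
    have ht := hW.coeffErase_ne_zero ha
    have ht' := hW.coeffErase_adj ha hc hac
    rw [coeffErase, coeffErase, ← Finset.mul_prod_erase _ _ hca,
      ← Finset.mul_prod_erase _ _ hac', Finset.erase_right_comm] at ht'
    rw [coeffErase] at ht
    have h₁ := pderiv_prod_X (v := v) (W := (W.erase a).erase c) (by simp [hv])
    have h₂ := pderiv_prod_X (v := a) (W := (W.erase a).erase c) (by simp)
    have h₃ := pderiv_prod_X (v := c) (W := (W.erase a).erase c) (by simp)
    rw [← Finset.mul_prod_erase _ _ hca] at ht ⊢
    simp only [elementForm]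
    set m : MvPolynomial V ℝ := ∏ w ∈ (W.erase a).erase c, X w
    -- `X c * m` and `X a * m` are the products over `W` without `a` and without `c`. Their pairings
    -- are opposite, so the difference gives twice a non-zero number.
    have h : pderiv v (pderiv v (X v * ((X v + X a) * (X c * m))) -
          pderiv a (X v * ((X v + X a) * (X c * m)))) -
        pderiv c (pderiv v (X v * ((X v + X a) * (X c * m))) -
          pderiv a (X v * ((X v + X a) * (X c * m)))) =
        X c * m - X a * m + X v * (-m) := by
      simp only [pderiv_mul, map_add, map_sub, pderiv_X_self, pderiv_X_of_ne hva,
        pderiv_X_of_ne hva.symm, pderiv_X_of_ne hvc, pderiv_X_of_ne hvc.symm,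
        pderiv_X_of_ne hac.ne, pderiv_X_of_ne hac.ne', h₁, h₂, h₃, map_zero, pderiv_one]
      ring
    rw [h, map_add, LinearMap.add_apply, pairing_X_mul_eq_zero (pderiv_graphPoly hv), map_sub,
      LinearMap.sub_apply, ht', add_zero, sub_neg_eq_add]
    exact mul_ne_zero hr (by simpa [← two_mul] using ht)
  · simp [hva.symm]

/-- The polynomial of a graph is orthogonal to polynomials not containing the ends of an edge. -/
theorem pairing_graphPoly_eq_zero {W : Finset V} {a b : V} (ha : a ∈ W) (hb : b ∈ W)
    (h : G.Adj a b) {Q : MvPolynomial V ℝ} (hQa : pderiv a Q = 0) (hQb : pderiv b Q = 0) :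
    pairing Q (graphPoly D W) = 0 := by
  obtain ⟨e, he⟩ := exists_edge h
  obtain ⟨c, -, hc⟩ := edgeForm_of_eq (D := D) he
  have heW : e ∈ edgesIn D W := by
    simpa [edgesIn, Inside] using (inside_of_eq (D := D) he).2 ⟨ha, hb⟩
  rw [graphPoly, ← Finset.mul_prod_erase _ _ heW, hc, mul_assoc, pairing_C_mul_right,
    pairing_mul_sub, hQa, hQb]
  simp

/-- A tree with a new vertex joined to two neighbours `b` and `c` of `a`. -/
theorem IsTreeOn.exists_isGood_square {v a b c : V} {W : Finset V} (hW : IsTreeOn D W)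
    (hv : v ∉ W) (ha : a ∈ W) (hb : b ∈ W) (hc : c ∈ W) (hab : G.Adj a b) (hac : G.Adj a c)
    (hbc : b ≠ c) {e f : G.edgeSet} (he : (e : Sym2 V) = s(v, b)) (hf : (f : Sym2 V) = s(v, c))
    (hef : e ≠ f) {r : ℝ} (hr : r ≠ 0)
    (hP : graphPoly D (insert v W) = C r * ((X v - X b) * ((X v - X c) * graphPoly D W))) :
    ∃ S, IsGood D (insert v W) S ∧ Sum.inl a ∉ S := by
  have hvb : v ≠ b := (ne_of_mem_of_not_mem hb hv).symm
  have hvc : v ≠ c := (ne_of_mem_of_not_mem hc hv).symm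
  have hba : b ∈ W.erase a := Finset.mem_erase.2 ⟨hab.ne', hb⟩
  have hcab : c ∈ (W.erase a).erase b :=
    Finset.mem_erase.2 ⟨hbc.symm, Finset.mem_erase.2 ⟨hac.ne', hc⟩⟩
  refine ⟨insert (Sum.inr e) (insert (Sum.inr f) ((W.erase a).image Sum.inl)), ⟨?_, ?_⟩, ?_⟩
  · rw [Finset.forall_mem_insert, Finset.forall_mem_insert]
    exact ⟨inside_edge hb he, inside_edge hc hf, inside_image_erase v a W⟩
  · rw [setForm_insert (by simp [hef]), setForm_insert (by simp), setForm_image_inl,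
      elementForm_of_eq he, elementForm_of_eq hf, hP, pairing_C_mul_right, pairing_mul_sub,
      pairing_mul_sub]
    have ht := hW.coeffErase_ne_zero ha
    rw [coeffErase] at ht
    have h₁ := pderiv_prod_X (v := v) (W := ((W.erase a).erase b).erase c) (by simp [hv])
    have h₂ := pderiv_prod_X (v := b) (W := ((W.erase a).erase b).erase c) (by simp)
    have h₃ := pderiv_prod_X (v := c) (W := ((W.erase a).erase b).erase c) (by simp)
    have h₄ := pderiv_prod_X (v := a) (W := ((W.erase a).erase b).erase c) (by simp)
    rw [← Finset.mul_prod_erase _ _ hba, ← Finset.mul_prod_erase _ _ hcab] at ht ⊢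
    set m : MvPolynomial V ℝ := ∏ w ∈ ((W.erase a).erase b).erase c, X w
    set Q := (X v + X b) * ((X v + X c) * (X b * (X c * m)))
    -- The main term is twice the product over `W` without `a`. Each square term lacks both ends of
    -- an edge, `ac` or `ab`, and so pairs to zero.
    have h : pderiv v (pderiv v Q - pderiv b Q) - pderiv c (pderiv v Q - pderiv b Q) =
        X b * (X c * m) + X b * (X c * m) - X b * X b * m - X c * X c * m +
          X v * (X v * m) := by
      simp only [Q, pderiv_mul, map_add, map_sub, pderiv_X_self, pderiv_X_of_ne hvb,
        pderiv_X_of_ne hvb.symm, pderiv_X_of_ne hvc, pderiv_X_of_ne hvc.symm,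
        pderiv_X_of_ne hbc, pderiv_X_of_ne hbc.symm, h₁, h₂, h₃, map_zero, pderiv_one]
      ring
    have hb0 : pairing (X b * X b * m) (graphPoly D W) = 0 :=
      pairing_graphPoly_eq_zero ha hc hac
        (by simp only [pderiv_mul, pderiv_X_of_ne hab.ne', h₄]; ring)
        (by simp only [pderiv_mul, pderiv_X_of_ne hbc, h₃]; ring)
    have hc0 : pairing (X c * X c * m) (graphPoly D W) = 0 :=
      pairing_graphPoly_eq_zero ha hb hab
        (by simp only [pderiv_mul, pderiv_X_of_ne hac.ne', h₄]; ring)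
        (by simp only [pderiv_mul, pderiv_X_of_ne hbc.symm, h₂]; ring)
    rw [h, map_add, LinearMap.add_apply, pairing_X_mul_eq_zero (pderiv_graphPoly hv), map_sub,
      LinearMap.sub_apply, map_sub, LinearMap.sub_apply, hb0, hc0, add_zero, sub_zero, sub_zero,
      map_add, LinearMap.add_apply]
    exact mul_ne_zero hr (by simpa [← two_mul] using ht)
  · simp

/-- In a connected graph with as many edges as vertices there is a good set that avoids a given
vertex. -/
theorem exists_isGood_unicyclic {W : Finset V} (hW : CutConnected G W)
    (hcard : (edgesIn D W).card = W.card) {a : V} (ha : a ∈ W) :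
    ∃ S, IsGood D W S ∧ Sum.inl a ∉ S := by
  induction hn : W.card generalizing W with
  | zero => simp_all
  | succ n ih =>
    by_cases hne : W = {a}
    · subst hne
      rw [Finset.card_singleton, Finset.card_eq_one] at hcard
      obtain ⟨e, he⟩ := hcard
      have : e ∈ edgesIn D {a} := by simp [he]
      simp only [edgesIn, Finset.mem_filter, Finset.mem_singleton] at this
      exact absurd (this.2.2.trans this.2.1.symm) (D.adj e).ne
    obtain ⟨v, W', hv, rfl, haW, hW', hadj⟩ := hW.exists_insert ha hne
    have hva : v ≠ a := (ne_of_mem_of_not_mem haW hv).symm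
    have h₁ := hW'.card_le (D := D)
    have h₂ := star_card_pos (D := D) hv hadj
    rw [Finset.card_insert_of_notMem hv] at hn
    rw [card_edgesIn_insert, Finset.card_insert_of_notMem hv] at hcard
    obtain hd | hd : (star D v W').card = 1 ∨ (star D v W').card = 2 := by omega
    · obtain ⟨S, hS, haS⟩ := ih hW' (by omega) haW (by omega)
      exact ⟨_, hS.insert_leaf hv hd, by simp [haS, hva.symm]⟩
    have hT : IsTreeOn D W' := ⟨hW', by omega⟩
    obtain ⟨b, c, e, f, r, hb, hc, hbc, hef, he, hf, hr, hP⟩ :=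
      graphPoly_insert_of_card_eq_two hv hd
    -- A neighbour `x` of `v` that is neither `a` nor adjacent to `a` can be left free along with
    -- `a` and then used for the trade. Otherwise `a` and `v` lie on a triangle or a square, where
    -- the set is explicit.
    have key : ∀ x (g : G.edgeSet), x ∈ W' → (g : Sym2 V) = s(v, x) → a ≠ x →
        ¬ G.Adj a x → ∃ S, IsGood D (insert v W') S ∧ Sum.inl a ∉ S := by
      intro x g hx hg hax hadj
      obtain ⟨S, hS, haS, hxS⟩ := hT.exists_isGood haW hx hax hadj
      obtain ⟨S', hS', h⟩ := hS.extend_two hv hd hg hx hxS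
      refine ⟨S', hS', fun haS' => ?_⟩
      rcases h a haS' with h | h | h
      exacts [hva h.symm, hax h, haS h]
    by_cases hab : a = b
    · subst hab
      by_cases hadj : G.Adj a c
      · exact hT.exists_isGood_triangle hv haW hc hadj he hr hP
      · exact key c f hc hf hbc hadj
    by_cases hac : a = c
    · subst hac
      by_cases hadj : G.Adj a b
      · exact hT.exists_isGood_triangle hv haW hb hadj hf hr (by rw [hP]; ring)
      · exact key b e hb he hab hadj
    by_cases hadj : G.Adj a b
    · by_cases hadj' : G.Adj a c
      · exact hT.exists_isGood_square hv haW hb hc hadj hadj' hbc he hf hef hr hP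
      · exact key c f hc hf hac hadj'
    · exact key b e hb he hab hadj

theorem exists_isGood_bicyclic {W : Finset V} (hW : CutConnected G W)
    (hcard : (edgesIn D W).card = W.card + 1) : ∃ S, IsGood D W S := by
  induction hn : W.card generalizing W with
  | zero => exact absurd hW.1 (by simp_all)
  | succ n ih =>
    obtain ⟨a, ha⟩ := hW.1
    by_cases hne : W = {a}
    · subst hne
      have : (edgesIn D {a}).Nonempty := Finset.card_pos.1 (by omega)
      obtain ⟨e, he⟩ := this
      simp only [edgesIn, Finset.mem_filter, Finset.mem_singleton] at he
      exact absurd (he.2.2.trans he.2.1.symm) (D.adj e).ne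
    obtain ⟨v, W', hv, rfl, -, hW', hadj⟩ := hW.exists_insert ha hne
    have h₁ := hW'.card_le (D := D)
    have h₂ := star_card_pos (D := D) hv hadj
    rw [Finset.card_insert_of_notMem hv] at hn
    rw [card_edgesIn_insert, Finset.card_insert_of_notMem hv] at hcard
    -- The remaining graph is bicyclic, unicyclic or a tree, respectively.
    obtain hd | hd | hd : (star D v W').card = 1 ∨ (star D v W').card = 2 ∨
      (star D v W').card = 3 := by omega
    · obtain ⟨S, hS⟩ := ih hW' (by omega) (by omega)
      exact ⟨_, hS.insert_leaf hv hd⟩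
    · obtain ⟨b, c, e, f, r, hb, hc, hbc, hef, he, hf, hr, hP⟩ :=
        graphPoly_insert_of_card_eq_two hv hd
      obtain ⟨S, hS, hbS⟩ := exists_isGood_unicyclic hW' (D := D) (by omega) hb
      obtain ⟨S', hS', -⟩ := hS.extend_two hv hd he hb hbS
      exact ⟨S', hS'⟩
    · have hT : IsTreeOn D W' := ⟨hW', by omega⟩
      obtain ⟨e₁, e₂, e₃, h₁₂, h₁₃, h₂₃, hs⟩ := Finset.card_eq_three.1 hd
      obtain ⟨u₁, hu₁, he₁⟩ := (mem_star (D := D) hv (e := e₁)).1 (by simp [hs])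
      obtain ⟨u₂, hu₂, he₂⟩ := (mem_star (D := D) hv (e := e₂)).1 (by simp [hs])
      obtain ⟨u₃, hu₃, he₃⟩ := (mem_star (D := D) hv (e := e₃)).1 (by simp [hs])
      have key : ∀ (x y : V) (e f : G.edgeSet), x ∈ W' → y ∈ W' → (e : Sym2 V) = s(v, x) →
          (f : Sym2 V) = s(v, y) → e ≠ f → ¬ G.Adj x y → ∃ S, IsGood D (insert v W') S := by
        intro x y e f hx hy he hf hef hadj
        obtain ⟨S, hS, hxS, hyS⟩ := hT.exists_isGood hx hy (ends_ne_of_ne he hf hef) hadj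
        exact hS.extend_three hv hd he hf hef hx hy hxS hyS
      -- Two of the three neighbours are non-adjacent, since a tree has no triangle.
      by_cases h₁₂' : G.Adj u₁ u₂
      · by_cases h₁₃' : G.Adj u₁ u₃
        · exact key u₂ u₃ e₂ e₃ hu₂ hu₃ he₂ he₃ h₂₃ (hT.no_triangle hu₁ hu₂ hu₃ h₁₂' h₁₃')
        · exact key u₁ u₃ e₁ e₃ hu₁ hu₃ he₁ he₃ h₁₃ h₁₃'
      · exact key u₁ u₂ e₁ e₂ hu₁ hu₂ he₁ he₂ h₁₂ h₁₂'

end Cycles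

/-! ### Permanents as coefficients of products of linear forms. -/

section LinearForms

variable {m n : Type*} [Fintype m] [DecidableEq m] [Fintype n] [DecidableEq n]

/-- The product over the rows of the linear forms given by a matrix. -/
noncomputable def rowProduct (A : Matrix m n ℝ) : MvPolynomial n ℝ :=
  ∏ i, ∑ j, C (A i j) * X j

theorem rowProduct_isHomogeneous (A : Matrix m n ℝ) :
    (rowProduct A).IsHomogeneous (Fintype.card m) := by
  have := IsHomogeneous.prod Finset.univ (fun i => ∑ j, C (A i j) * X j) (fun _ : m => 1)
    fun i _ => IsHomogeneous.sum _ _ _ fun j _ => by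
      simpa using (isHomogeneous_C n (A i j)).mul (isHomogeneous_X ℝ j)
  simpa [rowProduct] using this

theorem coeff_rowProduct (A : Matrix m n ℝ) (t : n →₀ ℕ) :
    coeff t (rowProduct A) =
      ∑ p : m → n with ∑ i, Finsupp.single (p i) 1 = t, ∏ i, A i (p i) := by
  rw [rowProduct, Finset.prod_univ_sum, Fintype.piFinset_univ, coeff_sum, Finset.sum_filter]
  refine Finset.sum_congr rfl fun p _ => ?_
  have : ∏ i, (X (p i) : MvPolynomial n ℝ) = monomial (∑ i, Finsupp.single (p i) 1) 1 :=
    (monomial_sum_one _ _).symm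
  rw [Finset.prod_mul_distrib, ← map_prod, coeff_C_mul, this, coeff_monomial]
  simp

theorem sum_single_apply (p : m → n) (j : n) :
    (∑ i, Finsupp.single (p i) 1 : n →₀ ℕ) j = (Finset.univ.filter fun i => p i = j).card := by
  simp [Finsupp.finsetSum_apply, Finsupp.single_apply]

/-- A choice `p` of one column per row giving this monomial uses each `c i` exactly once, so it is
`c` composed with a permutation. -/
theorem permanent_submatrix_eq_coeff (A : Matrix m n ℝ) {c : m → n} (hc : c.Injective) :
    (A.submatrix id c).permanent = coeff (∑ i, Finsupp.single (c i) 1) (rowProduct A) := by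
  rw [coeff_rowProduct, Matrix.permanent]
  refine Finset.sum_bij (fun σ _ => c ∘ σ.symm) (fun σ _ => ?_) (fun σ _ τ _ h => ?_)
    (fun p hp => ?_) fun σ _ => ?_
  · simpa using Equiv.sum_comp σ.symm fun i => Finsupp.single (c i) 1
  · have : σ.symm = τ.symm := Equiv.ext fun i => hc (congrFun h i)
    exact Equiv.symm_bijective.injective this
  · simp only [Finset.mem_filter, Finset.mem_univ, true_and] at hp
    have hcount (j : n) : (Finset.univ.filter fun i => p i = j).card =
        (Finset.univ.filter fun i => c i = j).card := by
      rw [← sum_single_apply, hp, sum_single_apply]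
    have hex (j : m) : ∃ i, c i = p j := by
      have h : 0 < (Finset.univ.filter fun i => p i = p j).card :=
        Finset.card_pos.2 ⟨j, by simp⟩
      rw [hcount] at h
      obtain ⟨i, hi⟩ := Finset.card_pos.1 h
      exact ⟨i, by simpa using hi⟩
    choose τ hτ using hex
    have hsurj : τ.Surjective := by
      intro i
      have h : 0 < (Finset.univ.filter fun k => c k = c i).card :=
        Finset.card_pos.2 ⟨i, by simp⟩
      rw [← hcount] at h
      obtain ⟨j, hj⟩ := Finset.card_pos.1 h
      exact ⟨j, hc ((hτ j).trans (by simpa using hj))⟩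
    refine ⟨(Equiv.ofBijective τ (Finite.surjective_iff_bijective.1 hsurj)).symm,
      Finset.mem_univ _, ?_⟩
    funext j
    exact hτ j
  · rw [← Equiv.prod_comp σ fun i => A i ((c ∘ σ.symm) i)]
    simp

/-- Any term of the non-zero coefficient is itself an enumeration of `S` by the rows; in particular
`S` has the right size. -/
theorem exists_permanent_ne_zero (A : Matrix m n ℝ) {S : Finset n}
    (h : coeff (∑ j ∈ S, Finsupp.single j 1) (rowProduct A) ≠ 0) :
    ∃ c : m → n, c.Injective ∧ (A.submatrix id c).permanent ≠ 0 := by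
  have h' := h
  rw [coeff_rowProduct] at h'
  obtain ⟨c, hc, -⟩ := Finset.exists_ne_zero_of_sum_ne_zero h'
  simp only [Finset.mem_filter, Finset.mem_univ, true_and] at hc
  have hinj : c.Injective := by
    intro i k hik
    have h₁ := sum_single_apply c (c k)
    rw [hc] at h₁
    have h₂ : (∑ j ∈ S, Finsupp.single j 1 : n →₀ ℕ) (c k) ≤ 1 := by
      simp only [Finsupp.finsetSum_apply, Finsupp.single_apply, Finset.sum_ite_eq']
      split_ifs <;> simp
    rw [h₁, Finset.card_le_one] at h₂
    exact h₂ i (by simpa using hik) k (by simp)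
  exact ⟨c, hinj, by rwa [permanent_submatrix_eq_coeff A hinj, hc]⟩

end LinearForms

/-! ### Substitution of the vertex weights, and the two conclusions. -/

section Substitution

variable {V : Type*} [Fintype V] [DecidableEq V] {G : SimpleGraph V} [DecidableRel G.Adj]

variable (G) in
/-- The weight of a vertex as a polynomial in the weights of the vertices and edges. -/
noncomputable def weightPoly (v : V) : MvPolynomial (V ⊕ G.edgeSet) ℝ :=
  X (Sum.inl v) +
    ∑ e ∈ Finset.univ.filter (fun e : G.edgeSet => v ∈ (e : Sym2 V)), X (Sum.inr e)

theorem eval_weightPoly (f : V ⊕ G.edgeSet → ℝ) (v : V) :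
    eval f (weightPoly G v) = weight G f v := by
  simp [weightPoly, weight]

/-- The derivation dual to the linear form of an element. -/
noncomputable def elementDeriv (D : Orientation G) :
    V ⊕ G.edgeSet → Derivation ℝ (MvPolynomial V ℝ) (MvPolynomial V ℝ)
  | Sum.inl v => pderiv v
  | Sum.inr e => pderiv (D.head e) + pderiv (D.tail e)

variable {D : Orientation G}

theorem pairing_elementForm_mul (z : V ⊕ G.edgeSet) (f g : MvPolynomial V ℝ) :
    pairing (elementForm D z * f) g = pairing f (elementDeriv D z g) := by
  cases z with
  | inl v => exact pairing_X_mul v f g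
  | inr e =>
    simp only [elementForm, elementDeriv, add_mul, map_add, LinearMap.add_apply, pairing_X_mul,
      Derivation.add_apply]

theorem mem_edge_iff (e : G.edgeSet) (v : V) :
    v ∈ (e : Sym2 V) ↔ v = D.head e ∨ v = D.tail e := by
  rw [D.ends e, Sym2.mem_iff, or_comm]

theorem pderiv_weightPoly (z : V ⊕ G.edgeSet) (v : V) :
    pderiv z (weightPoly G v) = aeval (weightPoly G) (elementDeriv D z (X v)) := by
  have hne := fun e => (D.adj e).ne
  cases z with
  | inl w => simp [weightPoly, elementDeriv, Pi.single_apply]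
  | inr e =>
    have hm := mem_edge_iff (D := D) e v
    simp [weightPoly, elementDeriv, Pi.single_apply, hm]
    have := hne e
    by_cases h₁ : v = D.head e
    · subst h₁
      simp [this.symm]
    · simp [h₁]

/-- The chain rule: the weight of an edge enters exactly the weights of its two ends. -/
theorem pderiv_aeval_weightPoly (z : V ⊕ G.edgeSet) (P : MvPolynomial V ℝ) :
    pderiv z (aeval (weightPoly G) P) = aeval (weightPoly G) (elementDeriv D z P) := by
  induction P using MvPolynomial.induction_on with
  | C a => simp
  | add p q hp hq => simp only [map_add, hp, hq]
  | mul_X p v hp =>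
    rw [map_mul, pderiv_mul, hp, aeval_X, pderiv_weightPoly (D := D), Derivation.leibniz,
      smul_eq_mul, smul_eq_mul, map_add, map_mul, map_mul, aeval_X]
    ring

theorem pairing_setForm (S : Finset (V ⊕ G.edgeSet)) (P : MvPolynomial V ℝ) :
    pairing (setForm D S) P = coeff (∑ z ∈ S, Finsupp.single z 1) (aeval (weightPoly G) P) := by
  induction S using Finset.induction_on generalizing P with
  | empty =>
    rw [setForm, Finset.prod_empty, pairing_one, Finset.sum_empty, ← constantCoeff_eq]
    have h : (constantCoeff.comp (aeval (weightPoly G)).toRingHom : MvPolynomial V ℝ →+* ℝ) =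
        constantCoeff := by
      refine MvPolynomial.ringHom_ext (fun r => by simp) fun v => ?_
      simp [weightPoly]
    exact (congrArg (fun f => f P) h).symm
  | insert z S hz ih =>
    rw [setForm, Finset.prod_insert hz, pairing_elementForm_mul, ← setForm, ih,
      ← pderiv_aeval_weightPoly, coeff_pderiv, Finset.sum_insert hz, add_comm]
    have : (∑ y ∈ S, Finsupp.single y 1 : V ⊕ G.edgeSet →₀ ℕ) z = 0 := by
      simp [Finsupp.finsetSum_apply, Finsupp.single_apply, hz]
    simp [this]

/-- The variable of `e` occurs in the weights of both ends and cancels, which is why `Meets`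
excludes `e`. No other edge contains both ends. -/
theorem aeval_edgeForm (e : G.edgeSet) :
    aeval (weightPoly G) (edgeForm D e) = ∑ z, C (matrixA D e z) * X z := by
  classical
  have hne := (D.adj e).ne
  have h₁ (w : V) : matrixA D e (Sum.inl w) =
      (if w = D.head e then 1 else 0) - (if w = D.tail e then 1 else 0) := by
    simp only [matrixA, Matrix.of_apply, Meets]
    by_cases h : w = D.head e
    · subst h
      simp [hne.symm]
    · by_cases h' : w = D.tail e <;> simp [h, h', hne]
  have h₂ (f : G.edgeSet) : matrixA D e (Sum.inr f) =
      (if D.head e ∈ (f : Sym2 V) then 1 else 0) - (if D.tail e ∈ (f : Sym2 V) then 1 else 0) := by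
    simp only [matrixA, Matrix.of_apply, Meets]
    by_cases hf : f = e
    · subst hf
      simp [mem_edge_iff (D := D)]
    · have : ¬ (D.head e ∈ (f : Sym2 V) ∧ D.tail e ∈ (f : Sym2 V)) := by
        rintro ⟨h, h'⟩
        exact hf (Subtype.ext (((Sym2.mem_and_mem_iff hne.symm).1 ⟨h, h'⟩).trans
          (by rw [D.ends e, Sym2.eq_swap])))
      have hf' : f ≠ e := hf
      by_cases h : D.head e ∈ (f : Sym2 V) <;> by_cases h' : D.tail e ∈ (f : Sym2 V) <;>
        simp_all
  rw [Fintype.sum_sum_type]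
  simp only [h₁, h₂, sub_mul, Finset.sum_sub_distrib, edgeForm, map_sub, aeval_X,
    weightPoly, Finset.sum_filter]
  simp only [apply_ite C, C_1, C_0, ite_mul, one_mul, zero_mul, Finset.sum_ite_eq',
    Finset.mem_univ, if_true]
  ring

theorem aeval_graphPoly_univ :
    aeval (weightPoly G) (graphPoly D Finset.univ) = rowProduct (matrixA D) := by
  have : edgesIn D Finset.univ = Finset.univ := by simp [edgesIn]
  rw [graphPoly, this, map_prod, rowProduct]
  exact Finset.prod_congr rfl fun e _ => aeval_edgeForm e

/-- Some square-free monomial occurs in the polynomial of a bicyclic graph. -/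
theorem IsBicyclic.exists_coeff_ne_zero (hG : IsBicyclic G) (D : Orientation G) :
    ∃ S : Finset (V ⊕ G.edgeSet),
      coeff (∑ z ∈ S, Finsupp.single z 1) (rowProduct (matrixA D)) ≠ 0 := by
  have hcard : (edgesIn D Finset.univ).card = (Finset.univ : Finset V).card + 1 := by
    have := hG.2
    rw [SimpleGraph.edgeFinset_card] at this
    simpa [edgesIn] using this
  obtain ⟨S, hS⟩ := exists_isGood_bicyclic (cutConnected_univ hG.1) hcard
  refine ⟨S, ?_⟩
  rw [← aeval_graphPoly_univ, ← pairing_setForm (D := D)]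
  exact hS.ne_zero

theorem IsBicyclic.pind_eq_one (hG : IsBicyclic G) (D : Orientation G) :
    pind (matrixA D) = 1 := by
  obtain ⟨S, hS⟩ := hG.exists_coeff_ne_zero D
  obtain ⟨c, hc, hper⟩ := exists_permanent_ne_zero _ hS
  have hmem : 1 ∈ columnMultiplicities (matrixA D) := by
    refine ⟨c, hper, fun j => ?_⟩
    refine Finset.card_le_one.2 fun a ha b hb => hc ?_
    simp only [Finset.mem_filter, Finset.mem_univ, true_and] at ha hb
    rw [ha, hb]
  refine le_antisymm ((iInf₂_le 1 hmem).trans_eq Nat.cast_one) (le_iInf₂ fun k hk => ?_)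
  obtain ⟨d, -, hd⟩ := hk
  -- There is at least one row, so some column is used at least once and `k = 0` is impossible.
  have h : 0 < G.edgeFinset.card := by
    rw [hG.2]
    omega
  obtain ⟨e, he⟩ := Finset.card_pos.1 h
  let e' : G.edgeSet := ⟨e, SimpleGraph.mem_edgeFinset.1 he⟩
  have hpos : 0 < (Finset.univ.filter fun i => d i = d e').card :=
    Finset.card_pos.2 ⟨e', by simp⟩
  have hk : 1 ≤ k := hpos.trans_le (hd (d e'))
  exact_mod_cast hk

theorem isChoosable_of_coeff_ne_zero (D : Orientation G) {S : Finset (V ⊕ G.edgeSet)}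
    (hS : coeff (∑ z ∈ S, Finsupp.single z 1) (rowProduct (matrixA D)) ≠ 0) :
    IsChoosable G 2 2 := by
  intro L hL
  have hL' (z : V ⊕ G.edgeSet) : (L z).card = 2 := by
    rw [hL z]
    cases z <;> rfl
  have hhom := rowProduct_isHomogeneous (matrixA D)
  -- By homogeneity the monomial has top degree, as the Nullstellensatz requires; its exponents are
  -- at most 1, below the list size 2.
  have hdeg : (rowProduct (matrixA D)).totalDegree =
      (∑ z ∈ S, Finsupp.single z 1 : V ⊕ G.edgeSet →₀ ℕ).degree := by
    rw [hhom.totalDegree fun h => hS (by rw [h, coeff_zero])]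
    by_contra hne
    exact hS (hhom.coeff_eq_zero (Ne.symm hne))
  obtain ⟨f, hf, hne⟩ := combinatorial_nullstellensatz_exists_eval_nonzero _ _ hS hdeg L
    fun z => by
      rw [hL']
      simp only [Finsupp.finsetSum_apply, Finsupp.single_apply, Finset.sum_ite_eq']
      split_ifs <;> simp
  refine ⟨f, hf, fun u v huv heq => hne ?_⟩
  obtain ⟨e, he⟩ := exists_edge huv
  rw [rowProduct, map_prod]
  refine Finset.prod_eq_zero (Finset.mem_univ e) ?_
  rw [← aeval_edgeForm, edgeForm, map_sub, aeval_X, aeval_X, map_sub, eval_weightPoly,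
    eval_weightPoly]
  rcases head_tail_of_eq (D := D) he with ⟨h₁, h₂⟩ | ⟨h₁, h₂⟩ <;> simp [h₁, h₂, heq]

theorem exists_orientation (G : SimpleGraph V) : Nonempty (Orientation G) :=
  ⟨⟨fun e => (Quot.out (e : Sym2 V)).1, fun e => (Quot.out (e : Sym2 V)).2,
    fun e => (Quot.out_eq (e : Sym2 V)).symm⟩⟩

end Substitution

end TotalWeight

theorem theorem3p3 {V : Type*} [Fintype V] [DecidableEq V] (B : SimpleGraph V)
    [DecidableRel B.Adj] (hB : TotalWeight.IsBicyclic B) :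
    (∀ D : TotalWeight.Orientation B, TotalWeight.pind (TotalWeight.matrixA D) = 1) ∧
      TotalWeight.IsChoosable B 2 2 := by
  refine ⟨fun D => hB.pind_eq_one D, ?_⟩
  obtain ⟨D⟩ := TotalWeight.exists_orientation B
  obtain ⟨S, hS⟩ := hB.exists_coeff_ne_zero D
  exact TotalWeight.isChoosable_of_coeff_ne_zero D hS
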